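/- Let $X$ be a metric space. For a family $\mathcal U$ of subsets of $X$ and $x\in X$ put $L_{\mathcal U}(x)=\sup_{U\in\mathcal U}\operatorname{dist}(x,X\setminus U)\in[0,\infty]$, where $\operatorname{dist}(x,\emptyset)=\infty$ and $\sup\emptyset=0$. The family $\mathcal U$ is called *coarse* if $L_{\mathcal U}(x_n)\to\infty$ for every sequence $(x_n)$ in $X$ with $x_n\to\infty$, i.e. with $d(x_n,x_0)\to\infty$ for every $x_0\in X$. A *coarse refinement* of a coarse family $\mathcal U$ is a coarse family $\mathcal V$ each of whose elements is contained in an element of $\mathcal U$. The *multiplicity* of $\mathcal V$ is the supremum over $x\in X$ of the number of elements of $\mathcal V$ containing $x$ (an element of $\{0,1,2,\dots\}\cup\{\infty\}$; it is $0$ if $X=\emptyset$). The *major coarse dimension* $\dim^{COA}_{RSE}(X)\in\{-1,0,1,\dots\}\cup\{\infty\}$ is the smallest integer $n$ such that every coarse family in $X$ has a coarse refinement of multiplicity at most $n+1$, and it is $\infty$ if there is no such $n$. **Theorem.** Let $A,B\subseteq X$ be subsets, equipped with the restricted metric, such that $X=A\cup B$. Then $$\dim^{COA}_{RSE}(X)=\max\bigl(\dim^{COA}_{RSE}(A),\dim^{COA}_{RSE}(B)\bigr).$$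 -/

import Mathlib

open Set Filter Topology

namespace CoarseDimension

noncomputable section

universe u

/-- The local Lebesgue number `L_𝒰(x) = sup {dist(x, X \ U) | U ∈ 𝒰} ∈ [0,∞]` of a family `𝒰` of
subsets of `X`; `infEDist` to the empty set is `∞`, so that `L_𝒰(x) = ∞` when `X ∈ 𝒰`, and the
supremum over the empty family is `0`. -/
def localLebesgueNumber {X : Type u} [MetricSpace X] (𝒰 : Set (Set X)) (x : X) : ENNReal :=
  ⨆ U ∈ 𝒰, Metric.infEDist x Uᶜ

/-- A function `f : X → [0,∞]` is coarsely proper if `f(xₙ) → ∞` whenever `xₙ → ∞` in `X`, that is,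
whenever the distance from `xₙ` to some (equivalently, every) base point tends to infinity. -/
def CoarselyProper {X : Type u} [MetricSpace X] (f : X → ENNReal) : Prop :=
  ∀ x : ℕ → X, (∀ x₀ : X, Tendsto (fun n => dist (x n) x₀) atTop atTop) →
    Tendsto (fun n => f (x n)) atTop (𝓝 ⊤)

/-- A family of subsets of `X` is coarse if its local Lebesgue number is coarsely proper. -/
def IsCoarse {X : Type u} [MetricSpace X] (𝒰 : Set (Set X)) : Prop :=
  CoarselyProper (localLebesgueNumber 𝒰)

/-- The global multiplicity of `𝒱`: the supremum over `x ∈ X` of the number of elements of `𝒱`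
containing `x`. -/
def familyMultiplicity {X : Type u} (𝒱 : Set (Set X)) : ℕ∞ :=
  ⨆ x : X, {V ∈ 𝒱 | x ∈ V}.encard

/-- `𝒱` is a coarse refinement of `𝒰`: it is coarse, and every element of `𝒱` is contained in an
element of `𝒰`. -/
def IsCoarseRefinement {X : Type u} [MetricSpace X] (𝒱 𝒰 : Set (Set X)) : Prop :=
  IsCoarse 𝒱 ∧ ∀ V ∈ 𝒱, ∃ U ∈ 𝒰, V ⊆ U

/-- Every coarse family in `X` has a coarse refinement of multiplicity at most `n + 1`. -/
def MajorCoarseDimLE (X : Type u) [MetricSpace X] (n : ℤ) : Prop :=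
  ∀ 𝒰 : Set (Set X), IsCoarse 𝒰 →
    ∃ 𝒱 : Set (Set X), IsCoarseRefinement 𝒱 𝒰 ∧ (familyMultiplicity 𝒱 : EReal) ≤ (((n : ℝ) + 1 : ℝ) : EReal)

/-- The major coarse dimension of `X`: the smallest integer `n` such that every coarse family in
`X` has a coarse refinement of multiplicity at most `n + 1`, and `∞` if there is none. Since a
multiplicity is never negative, only integers `n ≥ -1` occur. -/
def majorCoarseDim (X : Type u) [MetricSpace X] : EReal :=
  sInf {d : EReal | ∃ n : ℤ, MajorCoarseDimLE X n ∧ d = ((n : ℝ) : EReal)}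

end

end CoarseDimension

/-!
A family is coarse exactly when, for every `r`, each ball of radius `r` far enough out lies in an
element of the family. Hence the traces on `A ⊆ X` of a coarse family in `X` form a coarse family
in `A`, and every coarse family in `A` is refined by the nonempty traces of a coarse family in `X`,
so that the dimension of `A` is at most that of `X`.

For `X = A ∪ B` a coarse family `𝒰` is made thin over `A` and then over `B`, by shrinking each
element while keeping the family coarse. Over `A`, let `𝒱` be a coarse refinement of the trace of
`𝒰` on `A` and send each `V ∈ 𝒱` to some `c V ∈ 𝒰` containing it. From `U` one removes the points of
`A` that lie in no `V` with `c V = U`. A far ball missing `A` is unaffected by this. A far ball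
meeting `A` has its trace in a single `V`, but it must also lie in `c V`; so `𝒱` has to refine, not
the trace of `𝒰`, but that of the family of the sets `{x ∈ U | dist(x, X \ U) ≥ ρ x}`, where `ρ`
tends to infinity slowly enough for this family to be coarse.
-/

namespace CoarseDimension

open Bornology Metric

section PseudoMetricSpace

theorem tendsto_subtype_val_cobounded {X : Type*} [Bornology X] (A : Set X) :
    Tendsto ((↑) : A → X) (cobounded A) (cobounded X) :=
  tendsto_comap

variable {X : Type*} [PseudoMetricSpace X]

theorem isCountablyGenerated_cobounded : (cobounded X).IsCountablyGenerated := by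
  obtain _ | ⟨⟨x₀⟩⟩ := isEmpty_or_nonempty X
  · exact filter_eq_bot_of_isEmpty (cobounded X) ▸ inferInstance
  · exact comap_dist_right_atTop x₀ ▸ inferInstance

theorem eventually_cobounded_forall_mem_ball {p : X → Prop} (hp : ∀ᶠ x in cobounded X, p x)
    (r : ℝ) : ∀ᶠ x in cobounded X, ∀ y ∈ ball x r, p y := by
  have hbdd : IsBounded (thickening r {y | p y}ᶜ) := (isBounded_compl_iff.2 hp).thickening
  filter_upwards [isBounded_def.1 hbdd] with x hx y hy
  by_contra hpy
  exact hx (mem_thickening_iff.2 ⟨y, hpy, mem_ball'.1 hy⟩)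

theorem eventually_cobounded_forall_subtype_mem_ball {A : Set X} {p : A → Prop}
    (hp : ∀ᶠ a in cobounded A, p a) (r : ℝ) :
    ∀ᶠ x in cobounded X, ∀ a : A, (a : X) ∈ ball x r → p a := by
  have hp' : ∀ᶠ x in cobounded X, ∀ a : A, (a : X) = x → p a := eventually_comap.1 hp
  filter_upwards [eventually_cobounded_forall_mem_ball hp' r] with x hx a ha
  exact hx a ha a rfl

theorem ball_subset_iff_ofReal_le_infEDist_compl {x : X} {r : ℝ} {U : Set X} :
    ball x r ⊆ U ↔ ENNReal.ofReal r ≤ infEDist x Uᶜ := by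
  simp only [le_infEDist, edist_dist, ENNReal.ofReal_le_ofReal_iff dist_nonneg, subset_def,
    mem_ball', mem_compl_iff]
  exact forall_congr' fun y => by rw [← not_imp_not, not_lt]

end PseudoMetricSpace

section Coarse

variable {X : Type*} [MetricSpace X]

theorem coarselyProper_iff_tendsto {f : X → ENNReal} :
    CoarselyProper f ↔ Tendsto f (cobounded X) (𝓝 ⊤) := by
  have := isCountablyGenerated_cobounded (X := X)
  have hseq (x : ℕ → X) :
      (∀ x₀, Tendsto (fun n => dist (x n) x₀) atTop atTop) ↔ Tendsto x atTop (cobounded X) :=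
    ⟨fun h => (tendsto_dist_right_atTop_iff (x 0)).1 (h (x 0)),
      fun h x₀ => (tendsto_dist_right_atTop_iff x₀).2 h⟩
  simp only [CoarselyProper, hseq, tendsto_iff_seq_tendsto (k := cobounded X), Function.comp_def]

theorem exists_ball_subset_of_ofReal_lt_localLebesgueNumber {𝒰 : Set (Set X)} {x : X} {r : ℝ}
    (h : ENNReal.ofReal r < localLebesgueNumber 𝒰 x) : ∃ U ∈ 𝒰, ball x r ⊆ U := by
  obtain ⟨U, hU, hr⟩ : ∃ U ∈ 𝒰, ENNReal.ofReal r < infEDist x Uᶜ := by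
    simpa only [localLebesgueNumber, lt_iSup_iff, exists_prop] using h
  exact ⟨U, hU, ball_subset_iff_ofReal_le_infEDist_compl.2 hr.le⟩

theorem ofReal_le_localLebesgueNumber {𝒰 : Set (Set X)} {U : Set X} (hU : U ∈ 𝒰) {x : X} {r : ℝ}
    (h : ball x r ⊆ U) : ENNReal.ofReal r ≤ localLebesgueNumber 𝒰 x :=
  le_iSup₂_of_le U hU (ball_subset_iff_ofReal_le_infEDist_compl.1 h)

theorem localLebesgueNumber_le_add_edist (𝒰 : Set (Set X)) (x y : X) :
    localLebesgueNumber 𝒰 x ≤ localLebesgueNumber 𝒰 y + edist x y :=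
  iSup₂_le fun U hU => infEDist_le_infEDist_add_edist.trans <| by
    gcongr
    exact le_iSup₂_of_le U hU le_rfl

theorem isCoarse_iff_eventually_ball_subset {𝒰 : Set (Set X)} :
    IsCoarse 𝒰 ↔ ∀ r : ℝ, ∀ᶠ x in cobounded X, ∃ U ∈ 𝒰, ball x r ⊆ U := by
  rw [IsCoarse, coarselyProper_iff_tendsto]
  refine ⟨fun h r => ?_, fun h => ENNReal.tendsto_nhds_top fun n => ?_⟩
  · filter_upwards [h.eventually_const_lt ENNReal.ofReal_lt_top] with x hx
    exact exists_ball_subset_of_ofReal_lt_localLebesgueNumber hx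
  · filter_upwards [h (n + 1)] with x ⟨U, hU, hball⟩
    calc (n : ENNReal) = ENNReal.ofReal n := (ENNReal.ofReal_natCast n).symm
      _ < ENNReal.ofReal (n + 1) := (ENNReal.ofReal_lt_ofReal_iff (by positivity)).2 (lt_add_one _)
      _ ≤ localLebesgueNumber 𝒰 x := ofReal_le_localLebesgueNumber hU hball

theorem IsCoarse.diff_singleton_empty {𝒰 : Set (Set X)} (h𝒰 : IsCoarse 𝒰) :
    IsCoarse (𝒰 \ {∅}) := by
  rw [isCoarse_iff_eventually_ball_subset] at h𝒰 ⊢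
  intro r
  filter_upwards [h𝒰 (max r 1)] with x ⟨U, hU, hball⟩
  have hx : x ∈ U := hball (mem_ball_self (by positivity))
  exact ⟨U, ⟨hU, ne_of_mem_of_not_mem' hx (notMem_empty x)⟩,
    (ball_subset_ball (le_max_left r 1)).trans hball⟩

theorem IsCoarse.image_preimage {Y : Type*} [MetricSpace Y] {𝒰 : Set (Set X)} (h𝒰 : IsCoarse 𝒰)
    {f : Y → X} {K : NNReal} (hf : LipschitzWith K f)
    (hf_cobdd : Tendsto f (cobounded Y) (cobounded X)) : IsCoarse ((f ⁻¹' ·) '' 𝒰) := by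
  rw [isCoarse_iff_eventually_ball_subset] at h𝒰 ⊢
  intro r
  filter_upwards [hf_cobdd.eventually (h𝒰 (K * r + 1))] with y ⟨U, hU, hball⟩
  refine ⟨_, mem_image_of_mem _ hU, fun z hz => hball ?_⟩
  calc dist (f z) (f y) ≤ K * dist z y := hf.dist_le_mul z y
    _ ≤ K * r := by gcongr; exact (mem_ball.1 hz).le
    _ < K * r + 1 := lt_add_one _

theorem IsCoarse.image_preimage_val {𝒰 : Set (Set X)} (h𝒰 : IsCoarse 𝒰) (A : Set X) :
    IsCoarse ((((↑) : A → X) ⁻¹' ·) '' 𝒰) :=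
  h𝒰.image_preimage (.subtype_val A) (tendsto_subtype_val_cobounded A)

/-- The family of all subsets of `X` whose trace on `A` is empty or contained in an element of `𝒰`:
the largest family of subsets of `X` whose nonempty traces on `A` refine `𝒰`. -/
def extendFamily {A : Set X} (𝒰 : Set (Set A)) : Set (Set X) :=
  {W | (((↑) : A → X) ⁻¹' W).Nonempty → ∃ U ∈ 𝒰, ((↑) : A → X) ⁻¹' W ⊆ U}

theorem IsCoarse.extendFamily {A : Set X} {𝒰 : Set (Set A)} (h𝒰 : IsCoarse 𝒰) :
    IsCoarse (extendFamily 𝒰) := by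
  rw [isCoarse_iff_eventually_ball_subset] at h𝒰 ⊢
  intro r
  filter_upwards [eventually_cobounded_forall_subtype_mem_ball (h𝒰 (2 * r)) r] with x hx
  refine ⟨ball x r, fun ⟨a, ha⟩ => ?_, Subset.rfl⟩
  obtain ⟨U, hU, hball⟩ := hx a ha
  refine ⟨U, hU, fun b hb => hball ?_⟩
  calc dist (b : X) a ≤ dist (b : X) x + dist (a : X) x := dist_triangle_right _ _ _
    _ < 2 * r := by linarith [mem_ball.1 ha, mem_ball.1 hb]

end Coarse

section DeepPart

variable {X : Type*} [MetricSpace X]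

/-- The points `x` lying in `U` at depth at least `ρ x`, in the sense that the open ball of radius
`ρ x` around `x` is contained in `U`. -/
def deepPart (ρ : X → ℝ) (U : Set X) : Set X :=
  {x | ball x (ρ x) ⊆ U}

/-- The local Lebesgue number of `𝒰`, truncated at the distance to the base point `x₀` because it
may be infinite. -/
noncomputable def truncatedLebesgueNumber (𝒰 : Set (Set X)) (x₀ x : X) : ℝ :=
  (min (localLebesgueNumber 𝒰 x) (edist x x₀)).toReal

theorem min_localLebesgueNumber_edist_ne_top (𝒰 : Set (Set X)) (x₀ x : X) :
    min (localLebesgueNumber 𝒰 x) (edist x x₀) ≠ ⊤ :=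
  (min_lt_of_right_lt (edist_lt_top x x₀)).ne

theorem lipschitzWith_truncatedLebesgueNumber (𝒰 : Set (Set X)) (x₀ : X) :
    LipschitzWith 1 (truncatedLebesgueNumber 𝒰 x₀) := by
  refine LipschitzWith.of_le_add fun x y => ?_
  rw [dist_edist]
  refine ENNReal.toReal_le_add ?_ (min_localLebesgueNumber_edist_ne_top 𝒰 x₀ y)
    (edist_ne_top x y)
  rw [← min_add_add_right]
  refine min_le_min (localLebesgueNumber_le_add_edist 𝒰 x y) ?_
  rw [add_comm]
  exact edist_triangle x y x₀

theorem ofReal_lt_localLebesgueNumber_of_lt_truncatedLebesgueNumber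
    {𝒰 : Set (Set X)} {x₀ x : X} {r : ℝ}
    (h : r < truncatedLebesgueNumber 𝒰 x₀ x) (h0 : 0 ≤ r) :
    ENNReal.ofReal r < localLebesgueNumber 𝒰 x :=
  ((ENNReal.ofReal_lt_iff_lt_toReal h0
    (min_localLebesgueNumber_edist_ne_top 𝒰 x₀ x)).2 h).trans_le (min_le_left _ _)

theorem IsCoarse.tendsto_truncatedLebesgueNumber {𝒰 : Set (Set X)} (h𝒰 : IsCoarse 𝒰) (x₀ : X) :
    Tendsto (truncatedLebesgueNumber 𝒰 x₀) (cobounded X) atTop := by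
  have hedist : Tendsto (fun x => edist x x₀) (cobounded X) (𝓝 ⊤) := by
    simpa only [edist_dist, Function.comp_def] using
      ENNReal.tendsto_ofReal_atTop.comp (tendsto_dist_right_cobounded_atTop x₀)
  have hmin := (coarselyProper_iff_tendsto.1 h𝒰).min hedist
  rw [min_self] at hmin
  refine tendsto_atTop.2 fun r => ?_
  filter_upwards [hmin.eventually_const_lt ENNReal.ofReal_lt_top] with x hx
  exact (ENNReal.ofReal_le_iff_le_toReal (min_localLebesgueNumber_edist_ne_top 𝒰 x₀ x)).1 hx.le

theorem isCoarse_image_deepPart {𝒰 : Set (Set X)} {ρ : X → ℝ} (hρ : LipschitzWith 1 ρ)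
    (hρ_top : Tendsto ρ (cobounded X) atTop)
    (hball : ∀ᶠ x in cobounded X, ∃ U ∈ 𝒰, ball x (2 * ρ x) ⊆ U) :
    IsCoarse (deepPart ρ '' 𝒰) := by
  refine isCoarse_iff_eventually_ball_subset.2 fun r => ?_
  filter_upwards [hball, hρ_top.eventually_ge_atTop (2 * r)] with x ⟨U, hU, hxU⟩ hrx
  refine ⟨deepPart ρ U, mem_image_of_mem _ hU, fun y hy => Subset.trans ?_ hxU⟩
  refine ball_subset_ball' ?_
  have hρy : ρ y ≤ ρ x + dist y x := by
    simpa only [NNReal.coe_one, one_mul] using hρ.le_add_mul y x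
  linarith [mem_ball.1 hy]

theorem IsCoarse.exists_isCoarse_image_deepPart {𝒰 : Set (Set X)} (h𝒰 : IsCoarse 𝒰) :
    ∃ ρ : X → ℝ, Tendsto ρ (cobounded X) atTop ∧ IsCoarse (deepPart ρ '' 𝒰) := by
  obtain _ | ⟨⟨x₀⟩⟩ := isEmpty_or_nonempty X
  · exact ⟨0, filter_eq_bot_of_isEmpty (cobounded X) ▸ tendsto_bot, fun x => isEmptyElim (x 0)⟩
  have htop := h𝒰.tendsto_truncatedLebesgueNumber x₀
  have hρ_top : Tendsto (fun x => truncatedLebesgueNumber 𝒰 x₀ x / 3) (cobounded X) atTop :=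
    htop.atTop_div_const three_pos
  refine ⟨_, hρ_top, isCoarse_image_deepPart ?_ hρ_top ?_⟩
  · refine LipschitzWith.of_le_add fun x y => ?_
    have := (lipschitzWith_truncatedLebesgueNumber 𝒰 x₀).le_add_mul x y
    rw [NNReal.coe_one, one_mul] at this
    linarith [dist_nonneg (x := x) (y := y)]
  · filter_upwards [htop.eventually_gt_atTop 0] with x hx
    exact exists_ball_subset_of_ofReal_lt_localLebesgueNumber
      (ofReal_lt_localLebesgueNumber_of_lt_truncatedLebesgueNumber (x₀ := x₀)
        (by linarith) (by linarith))

end DeepPart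

section Multiplicity

variable {X Y : Type*}

theorem encard_setOf_mem_le_familyMultiplicity (𝒱 : Set (Set X)) (x : X) :
    {V ∈ 𝒱 | x ∈ V}.encard ≤ familyMultiplicity 𝒱 :=
  le_iSup (fun x : X => {V ∈ 𝒱 | x ∈ V}.encard) x

theorem familyMultiplicity_mono {𝒱 𝒲 : Set (Set X)} (h : 𝒱 ⊆ 𝒲) :
    familyMultiplicity 𝒱 ≤ familyMultiplicity 𝒲 :=
  iSup_mono fun _ => encard_le_encard fun _ hV => ⟨h hV.1, hV.2⟩

theorem familyMultiplicity_image_preimage_le (f : Y → X) (𝒱 : Set (Set X)) :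
    familyMultiplicity ((f ⁻¹' ·) '' 𝒱) ≤ familyMultiplicity 𝒱 := by
  refine iSup_le fun y => ?_
  have hsub : {W ∈ (f ⁻¹' ·) '' 𝒱 | y ∈ W} ⊆ (f ⁻¹' ·) '' {V ∈ 𝒱 | f y ∈ V} := by
    rintro _ ⟨⟨V, hV, rfl⟩, hy⟩
    exact mem_image_of_mem _ ⟨hV, hy⟩
  exact ((encard_le_encard hsub).trans (encard_image_le _ _)).trans
    (encard_setOf_mem_le_familyMultiplicity 𝒱 (f y))

end Multiplicity

section Shrink

variable {X : Type*}

/-- The set `U` with those points of `A` removed that lie in no member `V` of `𝒱` assigned to `U`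
by `c`; its trace on `A` is therefore covered by the members of `𝒱` assigned to `U`. -/
def shrink {A : Set X} (𝒱 : Set (Set A)) (c : Set A → Set X) (U : Set X) : Set X :=
  {x ∈ U | ∀ hx : x ∈ A, ∃ V ∈ 𝒱, c V = U ∧ ⟨x, hx⟩ ∈ V}

theorem shrink_subset {A : Set X} (𝒱 : Set (Set A)) (c : Set A → Set X) (U : Set X) :
    shrink 𝒱 c U ⊆ U :=
  sep_subset _ _

theorem encard_setOf_mem_shrink_le {A : Set X} (𝒰 : Set (Set X)) (𝒱 : Set (Set A))
    (c : Set A → Set X) {x : X} (hx : x ∈ A) :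
    {U ∈ 𝒰 | x ∈ shrink 𝒱 c U}.encard ≤ familyMultiplicity 𝒱 := by
  have hsub : {U ∈ 𝒰 | x ∈ shrink 𝒱 c U} ⊆ c '' {V ∈ 𝒱 | ⟨x, hx⟩ ∈ V} := by
    rintro U ⟨-, -, hxU⟩
    obtain ⟨V, hV, rfl, hxV⟩ := hxU hx
    exact mem_image_of_mem c ⟨hV, hxV⟩
  calc {U ∈ 𝒰 | x ∈ shrink 𝒱 c U}.encard
      ≤ {V ∈ 𝒱 | ⟨x, hx⟩ ∈ V}.encard := (encard_le_encard hsub).trans (encard_image_le _ _)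
    _ ≤ familyMultiplicity 𝒱 := encard_setOf_mem_le_familyMultiplicity 𝒱 ⟨x, hx⟩

theorem IsCoarse.image_shrink [MetricSpace X] {A : Set X} {𝒰 : Set (Set X)} {𝒱 : Set (Set A)}
    {c : Set A → Set X} {ρ : X → ℝ} (h𝒰 : IsCoarse 𝒰) (h𝒱 : IsCoarse 𝒱)
    (hρ : Tendsto ρ (cobounded X) atTop) (hc : ∀ V ∈ 𝒱, c V ∈ 𝒰)
    (hdeep : ∀ V ∈ 𝒱, ∀ a ∈ V, (a : X) ∈ deepPart ρ (c V)) : IsCoarse (shrink 𝒱 c '' 𝒰) := by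
  rw [isCoarse_iff_eventually_ball_subset] at h𝒰 h𝒱 ⊢
  intro r
  have hA : ∀ᶠ a : A in cobounded A, 2 * r ≤ ρ a ∧ ∃ V ∈ 𝒱, ball a (2 * r) ⊆ V :=
    ((tendsto_subtype_val_cobounded A).eventually (hρ.eventually_ge_atTop _)).and (h𝒱 _)
  filter_upwards [h𝒰 r, eventually_cobounded_forall_subtype_mem_ball hA r] with x ⟨U, hU, hxU⟩ hxA
  by_cases hmeet : ∃ a : A, (a : X) ∈ ball x r
  · obtain ⟨a, ha⟩ := hmeet
    obtain ⟨hρa, V, hV, haV⟩ := hxA a ha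
    have hball : ball x r ⊆ ball (a : X) (2 * r) :=
      ball_subset_ball' (by linarith [mem_ball'.1 ha])
    have ha_mem : a ∈ V := haV (mem_ball_self (by linarith [pos_of_mem_ball ha]))
    exact ⟨_, mem_image_of_mem _ (hc V hV), fun y hy =>
      ⟨hdeep V hV a ha_mem (ball_subset_ball hρa (hball hy)),
        fun _ => ⟨V, hV, rfl, haV (hball hy)⟩⟩⟩
  · exact ⟨_, mem_image_of_mem _ hU, fun y hy =>
      ⟨hxU hy, fun hyA => absurd ⟨⟨y, hyA⟩, hy⟩ hmeet⟩⟩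

end Shrink

section CoarseMultiplicityLE

/-- Every coarse family in `X` has a coarse refinement of multiplicity at most `m`. This is
`MajorCoarseDimLE` without the index shift and the casts to `EReal`. -/
def CoarseMultiplicityLE (X : Type*) [MetricSpace X] (m : ℕ∞) : Prop :=
  ∀ 𝒰 : Set (Set X), IsCoarse 𝒰 →
    ∃ 𝒱 : Set (Set X), IsCoarseRefinement 𝒱 𝒰 ∧ familyMultiplicity 𝒱 ≤ m

variable {X : Type*} [MetricSpace X]

theorem CoarseMultiplicityLE.subtype {m : ℕ∞} (hX : CoarseMultiplicityLE X m) (A : Set X) :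
    CoarseMultiplicityLE A m := by
  intro 𝒰 h𝒰
  obtain ⟨𝒱, ⟨h𝒱, href⟩, hm⟩ := hX _ h𝒰.extendFamily
  have hm_trace : familyMultiplicity ((((↑) : A → X) ⁻¹' ·) '' 𝒱 \ {∅}) ≤ m :=
    (familyMultiplicity_mono sdiff_subset).trans
      ((familyMultiplicity_image_preimage_le _ 𝒱).trans hm)
  refine ⟨_, ⟨(h𝒱.image_preimage_val A).diff_singleton_empty, ?_⟩, hm_trace⟩
  rintro _ ⟨⟨V, hV, rfl⟩, hne⟩
  obtain ⟨W, hW, hVW⟩ := href V hV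
  have htrace : ((↑) : A → X) ⁻¹' V ⊆ (↑) ⁻¹' W := preimage_mono hVW
  obtain ⟨U, hU, hWU⟩ := hW ((nonempty_iff_ne_empty.2 hne).mono htrace)
  exact ⟨U, hU, htrace.trans hWU⟩

theorem CoarseMultiplicityLE.exists_shrinking {A : Set X} {m : ℕ∞} (hA : CoarseMultiplicityLE A m)
    {𝒰 : Set (Set X)} (h𝒰 : IsCoarse 𝒰) :
    ∃ φ : Set X → Set X, (∀ U, φ U ⊆ U) ∧ IsCoarse (φ '' 𝒰) ∧
      ∀ x ∈ A, {U ∈ 𝒰 | x ∈ φ U}.encard ≤ m := by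
  obtain ⟨ρ, hρ, hdeep⟩ := h𝒰.exists_isCoarse_image_deepPart
  obtain ⟨𝒱, ⟨h𝒱, href⟩, hm⟩ := hA _ (hdeep.image_preimage_val A)
  simp only [exists_mem_image] at href
  choose! c hc𝒰 hc using href
  exact ⟨shrink 𝒱 c, shrink_subset 𝒱 c, h𝒰.image_shrink h𝒱 hρ hc𝒰 hc,
    fun x hx => (encard_setOf_mem_shrink_le 𝒰 𝒱 c hx).trans hm⟩

theorem CoarseMultiplicityLE.of_union_eq_univ {A B : Set X} (hAB : A ∪ B = univ) {m : ℕ∞}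
    (hA : CoarseMultiplicityLE A m) (hB : CoarseMultiplicityLE B m) :
    CoarseMultiplicityLE X m := by
  intro 𝒰 h𝒰
  obtain ⟨φ, hφ, hφ𝒰, hφA⟩ := hA.exists_shrinking h𝒰
  obtain ⟨ψ, hψ, hψ𝒰, hψB⟩ := hB.exists_shrinking hφ𝒰
  refine ⟨ψ '' (φ '' 𝒰), ⟨hψ𝒰, ?_⟩, iSup_le fun x => ?_⟩
  · rintro _ ⟨_, ⟨U, hU, rfl⟩, rfl⟩
    exact ⟨U, hU, (hψ _).trans (hφ U)⟩
  · rcases hAB.ge (mem_univ x) with hx | hx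
    · have hsub : {V ∈ ψ '' (φ '' 𝒰) | x ∈ V} ⊆ (ψ ∘ φ) '' {U ∈ 𝒰 | x ∈ φ U} := by
        rintro _ ⟨⟨_, ⟨U, hU, rfl⟩, rfl⟩, hxU⟩
        exact ⟨U, ⟨hU, hψ _ hxU⟩, rfl⟩
      exact ((encard_le_encard hsub).trans (encard_image_le _ _)).trans (hφA x hx)
    · have hsub : {V ∈ ψ '' (φ '' 𝒰) | x ∈ V} ⊆ ψ '' {U ∈ φ '' 𝒰 | x ∈ ψ U} := by
        rintro _ ⟨⟨U, hU, rfl⟩, hxU⟩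
        exact ⟨U, ⟨hU, hxU⟩, rfl⟩
      exact ((encard_le_encard hsub).trans (encard_image_le _ _)).trans (hψB x hx)

theorem coarseMultiplicityLE_iff_of_union_eq_univ {A B : Set X} (hAB : A ∪ B = univ) {m : ℕ∞} :
    CoarseMultiplicityLE X m ↔ CoarseMultiplicityLE A m ∧ CoarseMultiplicityLE B m :=
  ⟨fun h => ⟨h.subtype A, h.subtype B⟩, fun h => .of_union_eq_univ hAB h.1 h.2⟩

end CoarseMultiplicityLE

section MajorCoarseDim

theorem coe_ereal_le_intCast_add_one_iff {k : ℕ∞} {n : ℤ} :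
    (k : EReal) ≤ (((n : ℝ) + 1 : ℝ) : EReal) ↔ 0 ≤ n + 1 ∧ k ≤ (n + 1).toNat := by
  cases k with
  | top => simpa using EReal.coe_ne_top ((n : ℝ) + 1)
  | coe k =>
    have hcast : ((k : ℕ∞) : EReal) = ((k : ℝ) : EReal) :=
      congrArg ENNReal.toEReal (ENat.toENNReal_coe k)
    rw [hcast, EReal.coe_le_coe_iff, ENat.natCast_le_natCast]
    norm_cast
    omega

variable {X : Type*} [MetricSpace X]

theorem isCoarse_singleton_univ : IsCoarse {(univ : Set X)} :=
  isCoarse_iff_eventually_ball_subset.2 fun _ =>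
    Eventually.of_forall fun _ => ⟨univ, rfl, subset_univ _⟩

theorem majorCoarseDimLE_iff_coarseMultiplicityLE {n : ℤ} :
    MajorCoarseDimLE X n ↔ 0 ≤ n + 1 ∧ CoarseMultiplicityLE X (n + 1).toNat := by
  simp only [MajorCoarseDimLE, CoarseMultiplicityLE, coe_ereal_le_intCast_add_one_iff]
  refine ⟨fun h => ⟨?_, fun 𝒰 h𝒰 => ?_⟩, fun h 𝒰 h𝒰 => ?_⟩
  · obtain ⟨_, -, hn, -⟩ := h _ isCoarse_singleton_univ
    exact hn
  · obtain ⟨𝒱, href, -, hm⟩ := h 𝒰 h𝒰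
    exact ⟨𝒱, href, hm⟩
  · obtain ⟨𝒱, href, hm⟩ := h.2 𝒰 h𝒰
    exact ⟨𝒱, href, h.1, hm⟩

theorem majorCoarseDimLE_iff_of_union_eq_univ {A B : Set X} (hAB : A ∪ B = univ) {n : ℤ} :
    MajorCoarseDimLE X n ↔ MajorCoarseDimLE A n ∧ MajorCoarseDimLE B n := by
  simp only [majorCoarseDimLE_iff_coarseMultiplicityLE,
    coarseMultiplicityLE_iff_of_union_eq_univ hAB]
  tauto

theorem MajorCoarseDimLE.mono {m n : ℤ} (h : MajorCoarseDimLE X m) (hmn : m ≤ n) :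
    MajorCoarseDimLE X n := by
  intro 𝒰 h𝒰
  obtain ⟨𝒱, h𝒱, hm⟩ := h 𝒰 h𝒰
  exact ⟨𝒱, h𝒱, hm.trans (EReal.coe_le_coe_iff.2 (by gcongr))⟩

theorem majorCoarseDim_lt_iff {c : EReal} :
    majorCoarseDim X < c ↔ ∃ n : ℤ, MajorCoarseDimLE X n ∧ ((n : ℝ) : EReal) < c := by
  simp only [majorCoarseDim, sInf_lt_iff, mem_ofPred_eq]
  constructor
  · rintro ⟨_, ⟨n, hn, rfl⟩, hc⟩
    exact ⟨n, hn, hc⟩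
  · rintro ⟨n, hn, hc⟩
    exact ⟨_, ⟨n, hn, rfl⟩, hc⟩

end MajorCoarseDim

end CoarseDimension

theorem mainTheorem10 {X : Type*} [MetricSpace X] (A B : Set X) (hAB : A ∪ B = Set.univ) :
    CoarseDimension.majorCoarseDim X =
      max (CoarseDimension.majorCoarseDim A) (CoarseDimension.majorCoarseDim B) := by
  refine eq_of_forall_gt_iff fun c => ?_
  simp only [max_lt_iff, CoarseDimension.majorCoarseDim_lt_iff,
    CoarseDimension.majorCoarseDimLE_iff_of_union_eq_univ hAB]
  constructor
  · rintro ⟨n, ⟨hA, hB⟩, hn⟩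
    exact ⟨⟨n, hA, hn⟩, ⟨n, hB, hn⟩⟩
  · rintro ⟨⟨k, hA, hk⟩, ⟨l, hB, hl⟩⟩
    refine ⟨max k l, ⟨hA.mono (le_max_left k l), hB.mono (le_max_right k l)⟩, ?_⟩
    rcases max_choice k l with h | h <;> rwa [h]
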